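/- Let $c=2^{\aleph_0}$ be the cardinality of the continuum. Let $R$ be any one of the following three rings of functions, with pointwise addition and multiplication: 1. the ring of entire functions $\mathbb C\to\mathbb C$ of one complex variable; 2. the ring of entire functions of one complex variable of the form $z\mapsto\sum_{n=0}^\infty a_n z^n$ with all coefficients $a_n\in\mathbb R$ (the series converging for every $z\in\mathbb C$); 3. the ring of real analytic functions $\mathbb R\to\mathbb R$, i.e. functions that near each point of $\mathbb R$ are given by a convergent real power series. Then the Krull dimension of $R$ is at least $c$; that is, there is a set of prime ideals of $R$, totally ordered by inclusion, of cardinality at least $c$. -/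

import Mathlib

open Cardinal

/-- The ring of entire functions of one complex variable, under pointwise operations. -/
def entireRing : Subring (ℂ → ℂ) where
  carrier := {f | Differentiable ℂ f}
  mul_mem' hf hg := Differentiable.mul hf hg
  one_mem' := differentiable_const (1 : ℂ)
  add_mem' hf hg := Differentiable.add hf hg
  zero_mem' := differentiable_const (0 : ℂ)
  neg_mem' hf := Differentiable.neg hf

/-- The ring of everywhere convergent power series `∑ aₙ zⁿ` in one complex variable `z` with
real coefficients `aₙ`, regarded as functions on `ℂ`, under pointwise operations. -/
def realCoeffEntireRing : Subring (ℂ → ℂ) where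
  carrier := {f | ∃ a : ℕ → ℝ, ∀ z : ℂ, HasSum (fun n => (a n : ℂ) * z ^ n) (f z)}
  mul_mem' := by
    rintro f g ⟨a, ha⟩ ⟨b, hb⟩
    refine ⟨fun n => ∑ p ∈ Finset.HasAntidiagonal.antidiagonal n, a p.1 * b p.2, fun z => ?_⟩
    have h1 := (ha z).summable.norm
    have h2 := (hb z).summable.norm
    have h := (summable_norm_sum_mul_antidiagonal_of_summable_norm h1 h2).of_norm.hasSum
    rw [← tsum_mul_tsum_eq_tsum_sum_antidiagonal_of_summable_norm h1 h2, (ha z).tsum_eq,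
      (hb z).tsum_eq] at h
    refine Eq.mp (congrArg (fun u => HasSum u (f z * g z)) (funext fun n => ?_)) h
    push_cast
    rw [Finset.sum_mul]
    refine Finset.sum_congr rfl fun p hp => ?_
    rw [← Finset.HasAntidiagonal.mem_antidiagonal.1 hp, pow_add]
    ring
  one_mem' := by
    refine ⟨fun n => if n = 0 then 1 else 0, fun z => ?_⟩
    convert hasSum_single (f := fun n : ℕ => (((if n = 0 then 1 else 0 : ℝ)) : ℂ) * z ^ n) 0 ?_
    · simp
    · intro n hn
      simp [hn]
  add_mem' := by
    rintro f g ⟨a, ha⟩ ⟨b, hb⟩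
    refine ⟨fun n => a n + b n, fun z => ?_⟩
    simpa [add_mul] using (ha z).add (hb z)
  zero_mem' := ⟨fun _ => 0, fun z => by simp⟩
  neg_mem' := by
    rintro f ⟨a, ha⟩
    refine ⟨fun n => -a n, fun z => ?_⟩
    simpa using (ha z).neg

/-- The ring of real analytic functions on the real line, under pointwise operations. -/
def realAnalyticRing : Subring (ℝ → ℝ) where
  carrier := {f | ∀ x : ℝ, AnalyticAt ℝ f x}
  mul_mem' hf hg x := (hf x).mul (hg x)
  one_mem' _ := analyticAt_const
  add_mem' hf hg x := (hf x).add (hg x)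
  zero_mem' _ := analyticAt_const
  neg_mem' hf x := (hf x).neg

/-- The Krull dimension of `R` is at least the (possibly infinite) cardinal `κ`: some chain of
prime ideals of `R`, ordered by inclusion, has length at least `κ`. As usual a chain with `κ + 1`
members has length `κ`; for infinite `κ` one has `κ + 1 = κ`, so the condition is then that some
chain of prime ideals has at least `κ` members. -/
def KrullDimAtLeast (R : Type) [CommRing R] (κ : Cardinal.{0}) : Prop :=
  ∃ C : Set (PrimeSpectrum R), IsChain (· ≤ ·) C ∧ κ + 1 ≤ #C

/-! Orders of vanishing along a sequence of points are valuations `v n`. Fix a nonprincipal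
ultrafilter on the indices and a growth rate `h`; the functions whose orders eventually exceed every
multiple of `h` form a prime ideal. The rates `powFloor r`, for `0 < r < 1`, successively dominate
all multiples of one another, so the primes decrease as `r` grows. Strictness needs functions with
prescribed orders at the points. Genus zero Weierstrass products with fast-growing positive real
zeros provide them; being invariant under conjugation, they serve all three rings. -/

open Filter Topology

/-! ### Chains of primes from ultrafilters and growth rates -/

section PrimeChain

variable {R : Type} [CommRing R]

/-- The elements whose values along the ultrafilter `U` dominate every multiple of `h` form a
prime ideal. -/
theorem exists_prime_of_dominating (v : ℕ → R → ℕ∞)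
    (hmul : ∀ n f g, v n (f * g) = v n f + v n g)
    (hadd : ∀ n f g, min (v n f) (v n g) ≤ v n (f + g))
    (hzero : ∀ n, v n 0 = ⊤) (hone : ∀ n, v n 1 = 0)
    (U : Ultrafilter ℕ) (h : ℕ → ℕ) (hpos : ∀ᶠ n in U, 0 < h n) :
    ∃ P : PrimeSpectrum R,
      ∀ f, f ∈ P.asIdeal ↔ ∀ k : ℕ, ∀ᶠ n in U, ((k * h n : ℕ) : ℕ∞) ≤ v n f := by
  let I : Ideal R :=
    { carrier := {f | ∀ k : ℕ, ∀ᶠ n in U, ((k * h n : ℕ) : ℕ∞) ≤ v n f}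
      add_mem' := fun {f g} hf hg k => by
        filter_upwards [hf k, hg k] with n h1 h2
        exact (le_min h1 h2).trans (hadd n f g)
      zero_mem' := fun k => Eventually.of_forall fun n => by simp [hzero]
      smul_mem' := fun c f hf k => by
        filter_upwards [hf k] with n h1
        rw [smul_eq_mul, hmul]
        exact h1.trans le_add_self }
  have hI : ∀ f, f ∈ I ↔ ∀ k : ℕ, ∀ᶠ n in U, ((k * h n : ℕ) : ℕ∞) ≤ v n f := fun f => Iff.rfl
  refine ⟨⟨I, ⟨fun htop => ?_, fun {f g} hfg => ?_⟩⟩, hI⟩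
  · have h1 := (hI 1).1 (htop ▸ Submodule.mem_top) 1
    obtain ⟨n, hn, hn'⟩ := (h1.and hpos).exists
    rw [hone] at hn
    have : 1 * h n = 0 := by exact_mod_cast le_antisymm hn (zero_le)
    omega
  · by_contra hcon
    rw [not_or, hI, hI] at hcon
    -- Primality rests on the ultrafilter: failing to hold eventually means eventually failing, so
    -- both strict bounds hold together and add up.
    simp only [not_forall, ← Ultrafilter.eventually_not] at hcon
    obtain ⟨⟨k, hk⟩, l, hl⟩ := hcon
    obtain ⟨n, ⟨hn, hn'⟩, hn''⟩ := ((hk.and hl).and ((hI _).1 hfg (k + l))).exists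
    rw [hmul, add_mul, Nat.cast_add] at hn''
    exact absurd hn'' (not_le.2 (ENat.add_lt_add (not_le.1 hn) (not_le.1 hn')))

/-- A family of growth rates, each dominating every multiple of the earlier ones. -/
noncomputable def powFloor (r : ℝ) (n : ℕ) : ℕ := n ^ ⌊r * n⌋₊

theorem powFloor_pos (r : ℝ) {n : ℕ} (hn : 0 < n) : 0 < powFloor r n := pow_pos hn _

theorem powFloor_le {r : ℝ} (hr : r ≤ 1) (n : ℕ) : powFloor r n ≤ (n + 1) ^ n := by
  have h : ⌊r * n⌋₊ ≤ n := Nat.floor_le_of_le (mul_le_of_le_one_left n.cast_nonneg hr)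
  exact (Nat.pow_le_pow_left n.le_succ _).trans (Nat.pow_le_pow_right n.succ_pos h)

/-- Once `n ≥ 1 / (s - r)` the exponents differ by at least one; the extra factor `n` absorbs `k`.
-/
theorem eventually_mul_powFloor_le {r s : ℝ} (hr : 0 ≤ r) (hrs : r < s) (k : ℕ) :
    ∀ᶠ n : ℕ in atTop, k * powFloor r n ≤ powFloor s n := by
  have h1 : ∀ᶠ n : ℕ in atTop, 1 / (s - r) ≤ n :=
    tendsto_natCast_atTop_atTop.eventually_ge_atTop _
  filter_upwards [h1, eventually_ge_atTop k, eventually_gt_atTop 0] with n hn hk hpos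
  have hfl : ⌊r * n⌋₊ + 1 ≤ ⌊s * n⌋₊ := by
    rw [div_le_iff₀ (sub_pos.2 hrs)] at hn
    refine Nat.le_floor ?_
    push_cast
    have := Nat.floor_le (mul_nonneg hr n.cast_nonneg)
    linarith
  calc k * powFloor r n ≤ n * n ^ ⌊r * n⌋₊ := Nat.mul_le_mul_right _ hk
    _ = n ^ (⌊r * n⌋₊ + 1) := (pow_succ' _ _).symm
    _ ≤ powFloor s n := Nat.pow_le_pow_right hpos hfl

theorem krullDimAtLeast_continuum_of_orders (v : ℕ → R → ℕ∞)
    (hmul : ∀ n f g, v n (f * g) = v n f + v n g)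
    (hadd : ∀ n f g, min (v n f) (v n g) ≤ v n (f + g))
    (hzero : ∀ n, v n 0 = ⊤) (hone : ∀ n, v n 1 = 0)
    (hex : ∀ m : ℕ → ℕ, (∀ n, m n ≤ (n + 1) ^ n) → ∃ f, ∀ n, v n f = m n) :
    KrullDimAtLeast R 𝔠 := by
  let U : Ultrafilter ℕ := hyperfilter ℕ
  have hU : (U : Filter ℕ) ≤ atTop := Nat.hyperfilter_le_atTop
  have hpos : ∀ r, ∀ᶠ n in U, 0 < powFloor r n := fun r =>
    hU <| (eventually_gt_atTop 0).mono fun n hn => powFloor_pos r hn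
  choose P hP using fun r : ℝ =>
    exists_prime_of_dominating v hmul hadd hzero hone U (powFloor r) (hpos r)
  have hle : ∀ r s : ℝ, 0 ≤ r → r < s → P s ≤ P r := fun r s hr hrs f hf => by
    refine (hP r f).2 fun k => ?_
    filter_upwards [(hP s f).1 hf 1, hU (eventually_mul_powFloor_le hr hrs k)] with n h1 h2
    refine le_trans ?_ h1
    exact_mod_cast h2.trans (one_mul _).ge
  have hne : ∀ r s : ℝ, 0 ≤ r → r < s → s ≤ 1 → P r ≠ P s := fun r s hr hrs hs heq => by
    -- Orders equal to `powFloor s` put `f` in `P r`, but not in `P s`, since they do not reach `2 *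
    -- powFloor s`.
    obtain ⟨f, hf⟩ := hex (powFloor s) (powFloor_le hs)
    have hfr : f ∈ (P r).asIdeal := (hP r f).2 fun k => by
      filter_upwards [hU (eventually_mul_powFloor_le hr hrs k)] with n h2
      rw [hf]
      exact_mod_cast h2
    rw [heq, hP] at hfr
    obtain ⟨n, h1, h2⟩ := ((hfr 2).and (hpos s)).exists
    rw [hf, Nat.cast_le] at h1
    omega
  refine ⟨P '' Set.Ioo 0 1, ?_, ?_⟩
  · rintro _ ⟨r, hr, rfl⟩ _ ⟨s, hs, rfl⟩ hrs
    rcases lt_trichotomy r s with h | h | h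
    · exact Or.inr (hle r s hr.1.le h)
    · exact absurd (congrArg P h) hrs
    · exact Or.inl (hle s r hs.1.le h)
  · have hinj : Set.InjOn P (Set.Ioo 0 1) := fun r hr s hs hrs => by
      rcases lt_trichotomy r s with h | h | h
      · exact absurd hrs (hne r s hr.1.le h hs.2.le)
      · exact h
      · exact absurd hrs.symm (hne s r hs.1.le h hr.2.le)
    rw [Cardinal.mk_image_eq_of_injOn _ _ hinj, Cardinal.mk_Ioo_real one_pos,
      Cardinal.add_one_eq Cardinal.aleph0_le_continuum]

end PrimeChain

/-! ### Weierstrass products with prescribed real zeros -/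

section Weierstrass

/-- The genus zero Weierstrass product with a zero of order `m n` at `x n`. -/
noncomputable def zeroProduct (x : ℕ → ℝ) (m : ℕ → ℕ) (z : ℂ) : ℂ :=
  ∏' n, (1 - z / x n) ^ m n

theorem norm_one_sub_pow_sub_one_le (w : ℂ) (m : ℕ) :
    ‖(1 - w) ^ m - 1‖ ≤ (m * ‖w‖) * Real.exp (m * ‖w‖) := by
  have h1 := (Finset.range m).norm_prod_one_add_sub_one_le fun _ => -w
  simp only [Finset.prod_const, Finset.card_range, Finset.sum_const, norm_neg, nsmul_eq_mul,
    ← sub_eq_add_neg] at h1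
  refine h1.trans ?_
  -- Multiplying by `exp t`, with `t = m * ‖w‖`, gives `exp t - 1 ≤ t * exp t`.
  have h2 := Real.one_sub_le_exp_neg (m * ‖w‖)
  have h3 := mul_le_mul_of_nonneg_right h2 (Real.exp_pos (m * ‖w‖)).le
  rw [← Real.exp_add, neg_add_cancel, Real.exp_zero] at h3
  linarith

variable {x : ℕ → ℝ} {m : ℕ → ℕ}

theorem norm_zeroProduct_factor_le (hx : ∀ n, 0 < x n) (hm : ∀ n, m n / x n ≤ (1 / 2 : ℝ) ^ n)
    {z : ℂ} {B : ℝ} (hz : ‖z‖ ≤ B) (n : ℕ) :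
    ‖(1 - z / x n) ^ m n - 1‖ ≤ (1 / 2 : ℝ) ^ n * (B * Real.exp B) := by
  have hB : 0 ≤ B := (norm_nonneg z).trans hz
  have h1 : m n * ‖z / x n‖ ≤ (1 / 2 : ℝ) ^ n * B := by
    rw [norm_div, Complex.norm_real, Real.norm_of_nonneg (hx n).le]
    calc m n * (‖z‖ / x n) = m n / x n * ‖z‖ := by ring
      _ ≤ _ := mul_le_mul (hm n) hz (norm_nonneg z) (by positivity)
  have h2 : (1 / 2 : ℝ) ^ n * B ≤ B :=
    mul_le_of_le_one_left hB (pow_le_one₀ (by norm_num) (by norm_num))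
  calc _ ≤ _ := norm_one_sub_pow_sub_one_le _ _
    _ ≤ ((1 / 2 : ℝ) ^ n * B) * Real.exp B :=
      mul_le_mul h1 (Real.exp_le_exp.2 (h1.trans h2)) (Real.exp_pos _).le (by positivity)
    _ = _ := by ring

theorem summable_zeroProduct (hx : ∀ n, 0 < x n) (hm : ∀ n, m n / x n ≤ (1 / 2 : ℝ) ^ n) (z : ℂ) :
    Summable fun n => ‖(1 - z / x n) ^ m n - 1‖ :=
  Summable.of_nonneg_of_le (fun _ => norm_nonneg _)
    (norm_zeroProduct_factor_le hx hm le_rfl)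
    ((summable_geometric_of_lt_one (by norm_num) (by norm_num)).mul_right _)

theorem multipliable_zeroProduct (hx : ∀ n, 0 < x n) (hm : ∀ n, m n / x n ≤ (1 / 2 : ℝ) ^ n)
    (z : ℂ) : Multipliable fun n => (1 - z / x n) ^ m n := by
  simpa using multipliable_one_add_of_summable (summable_zeroProduct hx hm z)

theorem zeroProduct_ne_zero (hx : ∀ n, 0 < x n) (hm : ∀ n, m n / x n ≤ (1 / 2 : ℝ) ^ n) {z : ℂ}
    (hz : ∀ n, (1 - z / x n) ^ m n ≠ 0) : zeroProduct x m z ≠ 0 := by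
  simpa [zeroProduct] using tprod_one_add_ne_zero_of_summable
    (f := fun n => (1 - z / x n) ^ m n - 1) (by simpa using hz) (summable_zeroProduct hx hm z)

theorem differentiable_zeroProduct (hx : ∀ n, 0 < x n)
    (hm : ∀ n, m n / x n ≤ (1 / 2 : ℝ) ^ n) : Differentiable ℂ (zeroProduct x m) := by
  intro z
  let B := ‖z‖ + 1
  have hopen : IsOpen (Metric.ball (0 : ℂ) B) := Metric.isOpen_ball
  have hprod : HasProdLocallyUniformlyOn (fun n (w : ℂ) => 1 + ((1 - w / x n) ^ m n - 1))
      (fun w : ℂ => ∏' n, (1 + ((1 - w / x n) ^ m n - 1))) (Metric.ball (0 : ℂ) B) := by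
    refine Summable.hasProdLocallyUniformlyOn_nat_one_add hopen
      (u := fun n => (1 / 2 : ℝ) ^ n * (B * Real.exp B))
      ((summable_geometric_of_lt_one (by norm_num) (by norm_num)).mul_right _)
      (Eventually.of_forall fun n w hw => ?_) (fun n => by fun_prop)
    exact norm_zeroProduct_factor_le hx hm (mem_ball_zero_iff.1 hw).le n
  have hd := (hasProdLocallyUniformlyOn_iff_tendstoLocallyUniformlyOn.1 hprod).differentiableOn
    (Eventually.of_forall fun s => DifferentiableOn.fun_finsetProd fun n _ => by fun_prop) hopen
  simp only [add_sub_cancel] at hd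
  exact hd.differentiableAt (hopen.mem_nhds (by simp [B]))

theorem conj_zeroProduct (hx : ∀ n, 0 < x n) (hm : ∀ n, m n / x n ≤ (1 / 2 : ℝ) ^ n) (z : ℂ) :
    zeroProduct x m (starRingEnd ℂ z) = starRingEnd ℂ (zeroProduct x m z) := by
  have h := (multipliable_zeroProduct hx hm z).hasProd.map (starRingEnd ℂ) Complex.continuous_conj
  rw [zeroProduct, zeroProduct, ← h.tprod_eq]
  exact tprod_congr fun n => by simp

theorem update_zero_div_le (hm : ∀ n, m n / x n ≤ (1 / 2 : ℝ) ^ n) (k n : ℕ) :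
    (Function.update m k 0 n : ℕ) / x n ≤ (1 / 2 : ℝ) ^ n := by
  rcases eq_or_ne n k with rfl | h
  · simp
  · simpa [h] using hm n

/-- Setting the exponent at `k` to `0` deletes that factor without reindexing, so the cofactor is
again a `zeroProduct`. -/
theorem zeroProduct_eq_mul (hx : ∀ n, 0 < x n) (hm : ∀ n, m n / x n ≤ (1 / 2 : ℝ) ^ n) (k : ℕ)
    (z : ℂ) : zeroProduct x m z =
      (1 - z / x k) ^ m k * zeroProduct x (Function.update m k 0) z := by
  have h1 := (hasProd_ite_eq k ((1 - z / x k) ^ m k)).mul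
    (multipliable_zeroProduct hx (update_zero_div_le hm k) z).hasProd
  rw [zeroProduct, zeroProduct, ← h1.tprod_eq]
  refine tprod_congr fun n => ?_
  rcases eq_or_ne n k with rfl | h
  · simp
  · simp [h]

theorem zeroProduct_update_ne_zero (hx : ∀ n, 0 < x n) (hinj : Function.Injective x)
    (hm : ∀ n, m n / x n ≤ (1 / 2 : ℝ) ^ n) (k : ℕ) :
    zeroProduct x (Function.update m k 0) (x k) ≠ 0 := by
  refine zeroProduct_ne_zero hx (update_zero_div_le hm k) fun n => ?_
  rcases eq_or_ne n k with rfl | h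
  · simp
  · refine pow_ne_zero _ (sub_ne_zero.2 fun heq => h (hinj ?_))
    have hn : (x n : ℂ) ≠ 0 := by exact_mod_cast (hx n).ne'
    rw [eq_comm, div_eq_one_iff_eq hn] at heq
    exact_mod_cast heq.symm

theorem analyticOrderAt_eq_of_factor {𝕜 : Type*} [NontriviallyNormedField 𝕜] {f g : 𝕜 → 𝕜} {a : 𝕜}
    (ha : a ≠ 0) {k : ℕ} (hg : AnalyticAt 𝕜 g a) (hga : g a ≠ 0)
    (hf : ∀ z, f z = (1 - z / a) ^ k * g z) : analyticOrderAt f a = k := by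
  have hlin : AnalyticAt 𝕜 (fun z => (-a⁻¹) ^ k * g z) a := analyticAt_const.mul hg
  have hfac : ∀ z, f z = (z - a) ^ k • ((-a⁻¹) ^ k * g z) := fun z => by
    rw [hf, smul_eq_mul, ← mul_assoc, ← mul_pow]
    congr 2
    field_simp
    ring
  have hfa : AnalyticAt 𝕜 f a := by
    rw [funext hfac]
    exact ((analyticAt_id.sub analyticAt_const).pow k).smul hlin
  exact hfa.analyticOrderAt_eq_natCast.2
    ⟨_, hlin, mul_ne_zero (pow_ne_zero _ (neg_ne_zero.2 (inv_ne_zero ha))) hga,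
      Eventually.of_forall hfac⟩

theorem analyticOrderAt_zeroProduct (hx : ∀ n, 0 < x n) (hinj : Function.Injective x)
    (hm : ∀ n, m n / x n ≤ (1 / 2 : ℝ) ^ n) (k : ℕ) :
    analyticOrderAt (zeroProduct x m) (x k : ℂ) = m k :=
  analyticOrderAt_eq_of_factor (by exact_mod_cast (hx k).ne')
    ((differentiable_zeroProduct hx (update_zero_div_le hm k)).analyticAt _)
    (zeroProduct_update_ne_zero hx hinj hm k) (zeroProduct_eq_mul hx hm k)

theorem analyticAt_re_comp_ofReal {f : ℂ → ℂ} (hf : Differentiable ℂ f) (t : ℝ) :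
    AnalyticAt ℝ (fun s : ℝ => (f s).re) t :=
  (hf.analyticAt (t : ℂ)).re_ofReal

theorem analyticOrderAt_re_zeroProduct (hx : ∀ n, 0 < x n) (hinj : Function.Injective x)
    (hm : ∀ n, m n / x n ≤ (1 / 2 : ℝ) ^ n) (k : ℕ) :
    analyticOrderAt (fun t : ℝ => (zeroProduct x m t).re) (x k) = m k := by
  have hm' := update_zero_div_le hm k
  refine analyticOrderAt_eq_of_factor (hx k).ne'
    (analyticAt_re_comp_ofReal (differentiable_zeroProduct hx hm') _) (fun h0 => ?_) fun t => ?_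
  -- By conjugation symmetry the cofactor is real at real points, so a zero real part would make it
  -- vanish.
  · refine zeroProduct_update_ne_zero hx hinj hm k (Complex.ext h0 ?_)
    apply Complex.conj_eq_iff_im.1
    rw [← conj_zeroProduct hx hm', Complex.conj_ofReal]
  · rw [zeroProduct_eq_mul hx hm k, ← Complex.re_ofReal_mul]
    push_cast
    rfl

/-- Averaging the Taylor series at `z` with the conjugate of the one at the conjugate point replaces
each coefficient by its real part. -/
theorem zeroProduct_mem_realCoeffEntireRing (hx : ∀ n, 0 < x n)
    (hm : ∀ n, m n / x n ≤ (1 / 2 : ℝ) ^ n) : zeroProduct x m ∈ realCoeffEntireRing := by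
  let f := zeroProduct x m
  let c : ℕ → ℂ := fun n => (n.factorial : ℂ)⁻¹ * iteratedDeriv n f 0
  have hc : ∀ z, HasSum (fun n => c n * z ^ n) (f z) := fun z => by
    have h := Complex.hasSum_taylorSeries_of_entire (differentiable_zeroProduct hx hm) 0 z
    refine (congrArg (HasSum · _) (funext fun n => ?_)).mpr h
    simp only [c, f, smul_eq_mul, sub_zero]
    ring
  refine ⟨fun n => (c n).re, fun z => ?_⟩
  have h1 := (hc (starRingEnd ℂ z)).map (starRingEnd ℂ) Complex.continuous_conj
  rw [← conj_zeroProduct hx hm, Complex.conj_conj] at h1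
  have h2 := ((hc z).add h1).div_const 2
  rw [add_self_div_two] at h2
  refine (congrArg (HasSum · _) (funext fun n => ?_)).mpr h2
  simp [Complex.re_eq_add_conj]
  ring

end Weierstrass

/-! ### Application to the three rings -/

section Rings

theorem differentiable_of_mem_realCoeffEntireRing {f : ℂ → ℂ} (hf : f ∈ realCoeffEntireRing) :
    Differentiable ℂ f := by
  obtain ⟨a, ha⟩ := hf
  intro z
  let B : ℝ := ‖z‖ + 1
  have hB : 0 ≤ B := by positivity
  have hopen : IsOpen (Metric.ball (0 : ℂ) B) := Metric.isOpen_ball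
  -- Absolute convergence at the point `B` dominates the series on the ball of radius `B`.
  have hd := Complex.differentiableOn_tsum_of_summable_norm (F := fun n (w : ℂ) => (a n : ℂ) * w ^ n)
    (ha B).summable.norm (fun n => by fun_prop) hopen fun n w hw => by
      rw [norm_mul, norm_mul, norm_pow, norm_pow, Complex.norm_real B, Real.norm_of_nonneg hB]
      gcongr
      exact (mem_ball_zero_iff.1 hw).le
  rw [show f = fun w => ∑' n, (a n : ℂ) * w ^ n from funext fun w => (ha w).tsum_eq.symm]
  exact hd.differentiableAt (hopen.mem_nhds (by simp [B]))

/-- A sequence of positive reals, growing fast enough for the zero products to converge. -/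
noncomputable def zeroLocus (n : ℕ) : ℝ := (2 * (n + 1)) ^ n

theorem zeroLocus_pos (n : ℕ) : 0 < zeroLocus n := by
  unfold zeroLocus
  positivity

theorem zeroLocus_injective : Function.Injective zeroLocus := by
  refine (strictMono_nat_of_lt_succ fun n => ?_).injective
  unfold zeroLocus
  push_cast
  calc (2 * ((n : ℝ) + 1)) ^ n ≤ (2 * ((n : ℝ) + 1 + 1)) ^ n := by gcongr; linarith
    _ < (2 * ((n : ℝ) + 1 + 1)) ^ (n + 1) :=
      pow_lt_pow_right₀ (by linarith [n.cast_nonneg (α := ℝ)]) n.lt_succ_self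

/-- The bound `(n + 1) ^ n` covers every `powFloor r` with `r ≤ 1`, so one sequence of zeros works
for the whole chain. -/
theorem div_zeroLocus_le {m : ℕ → ℕ} (hm : ∀ n, m n ≤ (n + 1) ^ n) (n : ℕ) :
    m n / zeroLocus n ≤ (1 / 2 : ℝ) ^ n := by
  have h : (m n : ℝ) ≤ ((n : ℝ) + 1) ^ n := by exact_mod_cast hm n
  rwa [div_le_iff₀ (zeroLocus_pos n), zeroLocus, ← mul_pow, ← mul_assoc, one_div,
    inv_mul_cancel₀ two_ne_zero, one_mul]

theorem krullDimAtLeast_of_analytic {𝕜 : Type} [NontriviallyNormedField 𝕜] (S : Subring (𝕜 → 𝕜))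
    (hS : ∀ f ∈ S, ∀ z, AnalyticAt 𝕜 f z) (p : ℕ → 𝕜)
    (hex : ∀ m : ℕ → ℕ, (∀ n, m n ≤ (n + 1) ^ n) →
      ∃ f ∈ S, ∀ n, analyticOrderAt f (p n) = m n) :
    KrullDimAtLeast S 𝔠 := by
  refine krullDimAtLeast_continuum_of_orders (fun n f => analyticOrderAt (f : 𝕜 → 𝕜) (p n))
    (fun n f g => analyticOrderAt_mul (hS f f.2 _) (hS g g.2 _))
    (fun n f g => le_analyticOrderAt_add)
    (fun n => analyticOrderAt_eq_top.2 (Eventually.of_forall fun _ => rfl))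
    (fun n => analyticOrderAt_eq_zero.2 (Or.inr one_ne_zero)) fun m hm => ?_
  obtain ⟨f, hf, h⟩ := hex m hm
  exact ⟨⟨f, hf⟩, h⟩

end Rings

theorem corollary3p13 :
    KrullDimAtLeast entireRing 𝔠 ∧
    KrullDimAtLeast realCoeffEntireRing 𝔠 ∧
    KrullDimAtLeast realAnalyticRing 𝔠 := by
  refine ⟨krullDimAtLeast_of_analytic _ (fun f hf z => Differentiable.analyticAt hf z)
      (fun n => (zeroLocus n : ℂ)) fun m hm => ?_,
    krullDimAtLeast_of_analytic _
      (fun f hf z => (differentiable_of_mem_realCoeffEntireRing hf).analyticAt z)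
      (fun n => (zeroLocus n : ℂ)) fun m hm => ?_,
    krullDimAtLeast_of_analytic _ (fun f hf z => hf z) zeroLocus fun m hm => ?_⟩
  · exact ⟨_, differentiable_zeroProduct zeroLocus_pos (div_zeroLocus_le hm),
      analyticOrderAt_zeroProduct zeroLocus_pos zeroLocus_injective (div_zeroLocus_le hm)⟩
  · exact ⟨_, zeroProduct_mem_realCoeffEntireRing zeroLocus_pos (div_zeroLocus_le hm),
      analyticOrderAt_zeroProduct zeroLocus_pos zeroLocus_injective (div_zeroLocus_le hm)⟩
  · exact ⟨_, analyticAt_re_comp_ofReal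
        (differentiable_zeroProduct zeroLocus_pos (div_zeroLocus_le hm)),
      analyticOrderAt_re_zeroProduct zeroLocus_pos zeroLocus_injective (div_zeroLocus_le hm)⟩
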